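/- Let $(P_i,p_i)_{i=0,\dots,3}$ be a matched $4$-tuple: points $P_i\in\mathbb R^3$ and points $p_i\in\mathbb R^3$ (for example canvas points on the plane $z=1$) with $p_i\cdot p_3\neq 0$ for all $i$; $p_i$ represents the line $L_i=\mathbb R p_i$. The $4$-point perspective problem for the tuple is called solvable if there is a rigid transformation (isometry) $T$ of $\mathbb R^3$ with $T(P_i)\in L_i$ for all $i$. For $i\in\{0,1,2\}$ and $j\equiv i+1$, $k\equiv i+2 \pmod 3$ put $$a_i=\|P_j-P_k\|^2,\quad b_i=\frac{(p_i\cdot p_i)(p_3\cdot p_3)}{(p_i\cdot p_3)^2},\quad c_i=\|P_i-P_3\|^2,\quad d_i=\frac{(p_j\cdot p_k)(p_3\cdot p_3)}{(p_j\cdot p_3)(p_k\cdot p_3)}.$$ Let $I$ be the ideal generated by the six polynomials expressing $$a_i=b_jz_j^2+b_kz_k^2-2d_iz_jz_k,\qquad c_i=z_3^2+b_iz_i^2-2z_iz_3\qquad(i=0,1,2)\tag{1}$$ in the twelve variables $a_\bullet,b_\bullet,c_\bullet,d_\bullet$ and $z_0,\dots,z_3$. Let $Q_i(x)=X_{i,2}x^2+X_{i,1}x+X_{i,0}$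 ($0\le i\le 3$), with $X_{i,j}$ polynomials in the twelve variables, be the following quadratic polynomials, for which $Q_i(z_i^2)\in I$: $Q_0$ and $Q_3$ are given by the explicit formulas for $X_{0,j}$ and $X_{3,j}$ computed by elimination (written out in full as \texttt{coeff00}, \texttt{coeff01}, \texttt{coeff02}, \texttt{coeff30}, \texttt{coeff31}, \texttt{coeff32} in the formal definitions), and $Q_1$, $Q_2$ arise from $Q_0$ by exchanging the index $0$ with $1$, respectively $2$, in all variables. Write $\tau_{r,s}$ for the exchange of the indices $r,s$ in the twelve variables, let $\tau\in\{\tau_{0,1},\tau_{0,2}\}$, put $\sigma_0=\tau_{1,2}$, $\sigma_1=\tau_{0,2}$, $\sigma_2=\tau_{0,1}$, $\sigma_3=\tau$, and let $$\ell_i=\sigma_i(X_{i,2})\,Q_i(z_i^2)-X_{i,2}\,(\sigma_iQ_i)(z_i^2),$$ which is linear in $z_i^2$. Let $g_{i,i}\in\mathbb R(a_\bullet,b_\bullet,c_\bullet,d_\bullet)$ be the solution $z_i^2$ of $\ell_i=0$, and for $i\ne j$ let $g_{i,j}=g_{j,i}$ be the rational function obtained by solving the equation of (1) that contains $z_iz_j$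 for $z_iz_j$ and substituting $g_{m,m}$ for each $z_m^2$. Consider the polynomial constraints obtained by clearing denominators (that is, by setting the numerator in lowest terms of the difference of the two sides to zero) in $$g_{i,i}\,g_{j,j}=g_{i,j}^2\ \ (i<j),\qquad g_{i,j}\,g_{j,k}=g_{i,k}\,g_{j,j}\ \ (i,j,k\text{ distinct}).$$ (a) If the perspective problem for the tuple is solvable, then the values of $a_\bullet,b_\bullet,c_\bullet,d_\bullet$ on the tuple satisfy all these polynomial constraints. (b) Conversely, suppose that at the values $a_\bullet,b_\bullet,c_\bullet,d_\bullet$ of the tuple no $d_i$ is zero, none of the denominators (in lowest terms) of the $g_{i,i}$ is zero, and all the polynomial constraints hold. Then the perspective problem for the tuple is solvable. If moreover no $g_{i,i}$ vanishes at these values, then $T$ can be chosen with $T(P_i)\neq 0$ for all $i$. -/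

import Mathlib

namespace FourPoint

/-- Three-dimensional Euclidean space. -/
abbrev E3 : Type := EuclideanSpace ℝ (Fin 3)

/-- The twelve variables `a_i, b_i, c_i, d_i`, `i = 0, 1, 2`. -/
inductive Var : Type
  | a (i : Fin 3)
  | b (i : Fin 3)
  | c (i : Fin 3)
  | d (i : Fin 3)

/-- A permutation of the indices `{0, 1, 2}` acts on the variables. -/
def Var.perm (σ : Equiv.Perm (Fin 3)) : Var → Var
  | .a i => .a (σ i)
  | .b i => .b (σ i)
  | .c i => .c (σ i)
  | .d i => .d (σ i)

/-- Polynomials in the twelve variables. -/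
abbrev Poly : Type := MvPolynomial Var ℝ

/-- Rational functions in the twelve variables. -/
abbrev RatFun : Type := FractionRing Poly

section Coefficients

set_option linter.unusedVariables false

variable {R : Type*} [CommRing R]

/-- The constant coefficient of the quadratic polynomial `Q_0`. -/
def coeff00 (a0 a1 a2 b0 b1 b2 c0 c1 c2 d0 d1 d2 : R) : R :=
    c0^2*a0*b1*d0*d1 - 2*c0*c1*a0*b1*d0*d1 + c1^2*a0*b1*d0*d1 + c0^2*a1*b1*d0*d1
    - 2*c0*c1*a1*b1*d0*d1 + c1^2*a1*b1*d0*d1 - c0^2*a2*b1*d0*d1 + 2*c0*c1*a2*b1*d0*d1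
    - c1^2*a2*b1*d0*d1 + 2*c0*a0*a2*b1*d0*d1 - 2*c1*a0*a2*b1*d0*d1 + 2*c0*a1*a2*b1*d0*d1
    - 2*c1*a1*a2*b1*d0*d1 - 2*c0*a2^2*b1*d0*d1 + 2*c1*a2^2*b1*d0*d1 + a0*a2^2*b1*d0*d1
    + a1*a2^2*b1*d0*d1 - a2^3*b1*d0*d1 - c0^2*a0*b1*b2*d2 + 2*c0*c1*a0*b1*b2*d2 - c1^2*a0*b1*b2*d2
    - c0*a0^2*b1*b2*d2 + c1*a0^2*b1*b2*d2 + c0^2*a1*b1*b2*d2 - 2*c0*c1*a1*b1*b2*d2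
    + c1^2*a1*b1*b2*d2 + 2*c0*a0*a1*b1*b2*d2 - 2*c1*a0*a1*b1*b2*d2 - c0*a1^2*b1*b2*d2
    + c1*a1^2*b1*b2*d2 + c0^2*a2*b1*b2*d2 - 2*c0*c1*a2*b1*b2*d2 + c1^2*a2*b1*b2*d2
    - a0^2*a2*b1*b2*d2 + 2*a0*a1*a2*b1*b2*d2 - a1^2*a2*b1*b2*d2 + c0*a2^2*b1*b2*d2
    - c1*a2^2*b1*b2*d2 + a0*a2^2*b1*b2*d2 - a1*a2^2*b1*b2*d2 - 2*c0^2*a1*d0^2*d2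
    + 4*c0*c1*a1*d0^2*d2 - 2*c1^2*a1*d0^2*d2 + 2*a1*a2^2*d0^2*d2 - c0*a0^2*b1*b2 - c1*a0^2*b1*b2
    + 2*c0*a0*a1*b1*b2 + 2*c1*a0*a1*b1*b2 - c0*a1^2*b1*b2 - c1*a1^2*b1*b2 + 2*c0*a0*a2*b1*b2
    + 2*c1*a0*a2*b1*b2 + a0^2*a2*b1*b2 - 2*c0*a1*a2*b1*b2 - 2*c1*a1*a2*b1*b2 - 2*a0*a1*a2*b1*b2
    + a1^2*a2*b1*b2 - c0*a2^2*b1*b2 - c1*a2^2*b1*b2 - 2*a0*a2^2*b1*b2 + 2*a1*a2^2*b1*b2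
    + a2^3*b1*b2 + 4*c0*a1*a2*d0^2 + 4*c1*a1*a2*d0^2 - 4*a1*a2^2*d0^2 - 4*c0*a0*a2*d0*d1
    - 4*c0*a1*a2*d0*d1 + 4*c0*a2^2*d0*d1 + 2*c0*a0^2*b2*d2 - 4*c0*a0*a1*b2*d2 + 2*c0*a1^2*b2*d2
    - 2*c0*a2^2*b2*d2

/-- The linear coefficient of the quadratic polynomial `Q_0`. -/
def coeff01 (a0 a1 a2 b0 b1 b2 c0 c1 c2 d0 d1 d2 : R) : R :=
    -4*c0*a0*b0*b1*d0*d1 + 4*c1*a0*b0*b1*d0*d1 - 4*c0*a1*b0*b1*d0*d1 + 4*c1*a1*b0*b1*d0*d1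
    + 4*c0*a2*b0*b1*d0*d1 - 4*c1*a2*b0*b1*d0*d1 - 4*a0*a2*b0*b1*d0*d1 - 4*a1*a2*b0*b1*d0*d1
    + 4*a2^2*b0*b1*d0*d1 - 2*c0^2*b0*b1*b2*d2 + 4*c0*c1*b0*b1*b2*d2 - 2*c1^2*b0*b1*b2*d2
    + 2*a0^2*b0*b1*b2*d2 - 4*a0*a1*b0*b1*b2*d2 + 2*a1^2*b0*b1*b2*d2 - 4*c0*a2*b0*b1*b2*d2
    + 4*c1*a2*b0*b1*b2*d2 - 4*a0*a2*b0*b1*b2*d2 + 4*a1*a2*b0*b1*b2*d2 + 2*c0^2*b0*d0^2*d2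
    - 4*c0*c1*b0*d0^2*d2 + 2*c1^2*b0*d0^2*d2 + 4*c0*a1*b0*d0^2*d2 - 4*c1*a1*b0*d0^2*d2
    - 4*a1*a2*b0*d0^2*d2 - 2*a2^2*b0*d0^2*d2 + 2*c0^2*b1*d1^2*d2 - 4*c0*c1*b1*d1^2*d2
    + 2*c1^2*b1*d1^2*d2 + 4*c0*a0*b1*d1^2*d2 - 4*c1*a0*b1*d1^2*d2 + 4*a0*a2*b1*d1^2*d2
    - 2*a2^2*b1*d1^2*d2 - 4*c0^2*d0*d1*d2^2 + 8*c0*c1*d0*d1*d2^2 - 4*c1^2*d0*d1*d2^2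
    + 4*a0*a2*d0*d1*d2^2 + 4*a1*a2*d0*d1*d2^2 + 2*c0^2*b2*d2^3 - 4*c0*c1*b2*d2^3 + 2*c1^2*b2*d2^3
    - 2*a0^2*b2*d2^3 + 4*a0*a1*b2*d2^3 - 2*a1^2*b2*d2^3 - 4*c0*a0*b0*b1*b2 - 4*c1*a0*b0*b1*b2
    + 4*c0*a1*b0*b1*b2 + 4*c1*a1*b0*b1*b2 + 4*c0*a2*b0*b1*b2 + 4*c1*a2*b0*b1*b2 + 4*a0*a2*b0*b1*b2
    - 4*a1*a2*b0*b1*b2 - 4*a2^2*b0*b1*b2 - 4*c0*a1*b0*d0^2 - 4*c1*a1*b0*d0^2 - 4*c0*a2*b0*d0^2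
    - 4*c1*a2*b0*d0^2 + 4*a1*a2*b0*d0^2 + 4*a2^2*b0*d0^2 + 4*c0*a0*b0*d0*d1 + 4*c0*a1*b0*d0*d1
    - 4*c0*a2*b0*d0*d1 + 4*a0*a2*b0*d0*d1 + 4*a1*a2*b0*d0*d1 - 4*a2^2*b0*d0*d1 - 4*c1*a0*b1*d0*d1
    - 4*c1*a1*b1*d0*d1 + 4*c1*a2*b1*d0*d1 + 4*a0*a2*b1*d0*d1 + 4*a1*a2*b1*d0*d1 - 4*a2^2*b1*d0*d1
    + 4*c0*a0*b1*d1^2 + 4*c1*a0*b1*d1^2 - 4*c0*a2*b1*d1^2 - 4*c1*a2*b1*d1^2 - 4*a0*a2*b1*d1^2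
    + 4*a2^2*b1*d1^2 + 4*c0*a0*b0*b2*d2 - 2*a0^2*b0*b2*d2 - 4*c0*a1*b0*b2*d2 + 4*a0*a1*b0*b2*d2
    - 2*a1^2*b0*b2*d2 + 4*c0*a2*b0*b2*d2 + 2*a2^2*b0*b2*d2 + 4*c1*a0*b1*b2*d2 - 2*a0^2*b1*b2*d2
    - 4*c1*a1*b1*b2*d2 + 4*a0*a1*b1*b2*d2 - 2*a1^2*b1*b2*d2 - 4*c1*a2*b1*b2*d2 + 2*a2^2*b1*b2*d2
    + 8*c1*a1*d0^2*d2 + 8*c0*a2*d0*d1*d2 + 8*c1*a2*d0*d1*d2 - 8*a0*a2*d0*d1*d2 - 8*a1*a2*d0*d1*d2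
    - 8*c0*a0*d1^2*d2 + 4*a0^2*b2*d2^2 - 8*a0*a1*b2*d2^2 + 4*a1^2*b2*d2^2 - 4*c0*a2*b2*d2^2
    - 4*c1*a2*b2*d2^2

/-- The leading coefficient of the quadratic polynomial `Q_0`. -/
def coeff02 (a0 a1 a2 b0 b1 b2 c0 c1 c2 d0 d1 d2 : R) : R :=
    4*a0*b0^2*b1*d0*d1 + 4*a1*b0^2*b1*d0*d1 - 4*a2*b0^2*b1*d0*d1 + 4*c0*b0^2*b1*b2*d2
    - 4*c1*b0^2*b1*b2*d2 + 4*a0*b0^2*b1*b2*d2 - 4*a1*b0^2*b1*b2*d2 - 4*c0*b0^2*d0^2*d2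
    + 4*c1*b0^2*d0^2*d2 + 4*a2*b0^2*d0^2*d2 - 4*c0*b0*b1*d1^2*d2 + 4*c1*b0*b1*d1^2*d2
    - 8*a0*b0*b1*d1^2*d2 + 4*a2*b0*b1*d1^2*d2 + 8*c0*b0*d0*d1*d2^2 - 8*c1*b0*d0*d1*d2^2
    - 4*a0*b0*d0*d1*d2^2 - 4*a1*b0*d0*d1*d2^2 - 4*a2*b0*d0*d1*d2^2 - 4*c0*b0*b2*d2^3
    + 4*c1*b0*b2*d2^3 - 4*a0*b0*b2*d2^3 + 4*a1*b0*b2*d2^3 + 8*a0*d1^2*d2^3 - 4*c0*b0^2*b1*b2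
    - 4*c1*b0^2*b1*b2 + 4*a2*b0^2*b1*b2 + 4*c0*b0^2*d0^2 + 4*c1*b0^2*d0^2 - 4*a2*b0^2*d0^2
    - 4*a0*b0^2*d0*d1 - 4*a1*b0^2*d0*d1 + 4*a2*b0^2*d0*d1 - 4*a0*b0*b1*d0*d1 - 4*a1*b0*b1*d0*d1
    + 4*a2*b0*b1*d0*d1 + 4*c0*b0*b1*d1^2 + 4*c1*b0*b1*d1^2 - 4*a2*b0*b1*d1^2 - 4*a0*b0^2*b2*d2
    + 4*a1*b0^2*b2*d2 - 4*a2*b0^2*b2*d2 + 8*c1*b0*b1*b2*d2 - 4*a0*b0*b1*b2*d2 + 4*a1*b0*b1*b2*d2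
    - 4*a2*b0*b1*b2*d2 - 8*c1*b0*d0^2*d2 - 8*c0*b0*d0*d1*d2 - 8*c1*b0*d0*d1*d2 + 8*a0*b0*d0*d1*d2
    + 8*a1*b0*d0*d1*d2 + 8*a0*b0*d1^2*d2 - 8*c1*b1*d1^2*d2 + 8*a0*b1*d1^2*d2 + 4*c0*b0*b2*d2^2
    + 4*c1*b0*b2*d2^2 + 8*a0*b0*b2*d2^2 - 8*a1*b0*b2*d2^2 + 4*a2*b0*b2*d2^2 + 16*c1*d0*d1*d2^2
    - 16*a0*d1^2*d2^2 - 8*c1*b2*d2^3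

/-- The constant coefficient of the quadratic polynomial `Q_3`. -/
def coeff30 (a0 a1 a2 b0 b1 b2 c0 c1 c2 d0 d1 d2 : R) : R :=
    c0^2*c1*b0*b1*b2 + c0*c1^2*b0*b1*b2 - c0^2*c2*b0*b1*b2 + c1^2*c2*b0*b1*b2 - c0*c2^2*b0*b1*b2
    - c1*c2^2*b0*b1*b2 + c0^2*a1*b0*b1*b2 - c1^2*a1*b0*b1*b2 + 2*c0*c2*a1*b0*b1*b2
    + 2*c1*c2*a1*b0*b1*b2 - c0*a1^2*b0*b1*b2 - c1*a1^2*b0*b1*b2 - c0^2*a2*b0*b1*b2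
    - 2*c0*c1*a2*b0*b1*b2 - 2*c1*c2*a2*b0*b1*b2 + c2^2*a2*b0*b1*b2 + 2*c1*a1*a2*b0*b1*b2
    - 2*c2*a1*a2*b0*b1*b2 + a1^2*a2*b0*b1*b2 + c0*a2^2*b0*b1*b2 + c2*a2^2*b0*b1*b2
    - a1*a2^2*b0*b1*b2 - c0^3*b0*b1*d1 - 2*c0^2*c1*b0*b1*d1 - c0*c1^2*b0*b1*d1 + c0^2*c2*b0*b1*d1
    + 2*c0*c1*c2*b0*b1*d1 + c1^2*c2*b0*b1*d1 + c0^2*a1*b0*b1*d1 + 2*c0*c1*a1*b0*b1*d1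
    + c1^2*a1*b0*b1*d1 + 2*c0^2*a2*b0*b1*d1 + 2*c0*c1*a2*b0*b1*d1 - 2*c0*c2*a2*b0*b1*d1
    - 2*c1*c2*a2*b0*b1*d1 - 2*c0*a1*a2*b0*b1*d1 - 2*c1*a1*a2*b0*b1*d1 - c0*a2^2*b0*b1*d1
    + c2*a2^2*b0*b1*d1 + a1*a2^2*b0*b1*d1 + 2*c0^2*c2*b1*d1^2 - 2*c1^2*c2*b1*d1^2
    + 4*c1*c2*a2*b1*d1^2 - 2*c2*a2^2*b1*d1^2 + c0^3*b0*b2*d2 - c0^2*c1*b0*b2*d2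
    + 2*c0^2*c2*b0*b2*d2 - 2*c0*c1*c2*b0*b2*d2 + c0*c2^2*b0*b2*d2 - c1*c2^2*b0*b2*d2
    - 2*c0^2*a1*b0*b2*d2 + 2*c0*c1*a1*b0*b2*d2 - 2*c0*c2*a1*b0*b2*d2 + 2*c1*c2*a1*b0*b2*d2
    + c0*a1^2*b0*b2*d2 - c1*a1^2*b0*b2*d2 - c0^2*a2*b0*b2*d2 - 2*c0*c2*a2*b0*b2*d2
    - c2^2*a2*b0*b2*d2 + 2*c0*a1*a2*b0*b2*d2 + 2*c2*a1*a2*b0*b2*d2 - a1^2*a2*b0*b2*d2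
    - 4*c0^2*c2*d1^2*d2 + 4*c0*c1*c2*d1^2*d2 + 4*c0*c2*a2*d1^2*d2 - 2*c0^2*c1*b2*d2^2
    + 2*c1*c2^2*b2*d2^2 - 4*c1*c2*a1*b2*d2^2 + 2*c1*a1^2*b2*d2^2 + 4*c0^2*c1*d1*d2^2
    - 4*c0*c1*c2*d1*d2^2 - 4*c0*c1*a1*d1*d2^2

/-- The linear coefficient of the quadratic polynomial `Q_3`. -/
def coeff31 (a0 a1 a2 b0 b1 b2 c0 c1 c2 d0 d1 d2 : R) : R :=
    -4*c0*c1*b0*b1*b2 - 2*c1^2*b0*b1*b2 + 4*c0*c2*b0*b1*b2 + 2*c2^2*b0*b1*b2 - 4*c0*a1*b0*b1*b2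
    - 4*c2*a1*b0*b1*b2 + 2*a1^2*b0*b1*b2 + 4*c0*a2*b0*b1*b2 + 4*c1*a2*b0*b1*b2 - 2*a2^2*b0*b1*b2
    + 4*c0^2*b0*b1*d1 + 4*c0*c1*b0*b1*d1 - 4*c0*c2*b0*b1*d1 - 4*c1*c2*b0*b1*d1 - 4*c0*a1*b0*b1*d1
    - 4*c1*a1*b0*b1*d1 - 4*c0*a2*b0*b1*d1 + 4*c2*a2*b0*b1*d1 + 4*a1*a2*b0*b1*d1 - 2*c0^2*b1*d1^2
    + 2*c1^2*b1*d1^2 - 4*c0*c2*b1*d1^2 + 4*c1*c2*b1*d1^2 - 4*c1*a2*b1*d1^2 - 4*c2*a2*b1*d1^2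
    + 2*a2^2*b1*d1^2 - 4*c0^2*b0*b2*d2 + 4*c0*c1*b0*b2*d2 - 4*c0*c2*b0*b2*d2 + 4*c1*c2*b0*b2*d2
    + 4*c0*a1*b0*b2*d2 - 4*c1*a1*b0*b2*d2 + 4*c0*a2*b0*b2*d2 + 4*c2*a2*b0*b2*d2 - 4*a1*a2*b0*b2*d2
    + 4*c0^2*d1^2*d2 - 4*c0*c1*d1^2*d2 + 4*c0*c2*d1^2*d2 - 4*c1*c2*d1^2*d2 - 4*c0*a2*d1^2*d2
    - 4*c2*a2*d1^2*d2 + 2*c0^2*b2*d2^2 + 4*c0*c1*b2*d2^2 - 4*c1*c2*b2*d2^2 - 2*c2^2*b2*d2^2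
    + 4*c1*a1*b2*d2^2 + 4*c2*a1*b2*d2^2 - 2*a1^2*b2*d2^2 - 4*c0^2*d1*d2^2 - 4*c0*c1*d1*d2^2
    + 4*c0*c2*d1*d2^2 + 4*c1*c2*d1*d2^2 + 4*c0*a1*d1*d2^2 + 4*c1*a1*d1*d2^2 - 2*c0^2*b0*b1
    + 2*c1^2*b0*b1 + 4*c0*a1*b0*b1 + 4*c1*a1*b0*b1 - 4*c1*a2*b0*b1 - 4*a1*a2*b0*b1 + 2*a2^2*b0*b1
    + 2*c0^2*b0*b2 - 2*c2^2*b0*b2 + 4*c2*a1*b0*b2 - 2*a1^2*b0*b2 - 4*c0*a2*b0*b2 - 4*c2*a2*b0*b2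
    + 4*a1*a2*b0*b2 + 2*c1^2*b1*b2 - 2*c2^2*b1*b2 + 4*c2*a1*b1*b2 - 2*a1^2*b1*b2 - 4*c1*a2*b1*b2
    + 2*a2^2*b1*b2 - 4*c0^2*b0*d1 + 4*c0*c2*b0*d1 + 4*c0*a1*b0*d1 + 4*c0*a2*b0*d1 - 4*c2*a2*b0*d1
    - 4*a1*a2*b0*d1 - 4*c1^2*b1*d1 + 4*c0*c2*b1*d1 + 4*c0*a1*b1*d1 + 8*c1*a2*b1*d1 - 4*a2^2*b1*d1
    + 8*c2*a2*d1^2 + 4*c0^2*b0*d2 - 4*c0*c1*b0*d2 - 4*c0*a1*b0*d2 + 4*c1*a1*b0*d2 - 4*c0*a2*b0*d2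
    + 4*a1*a2*b0*d2 - 4*c0*c1*b2*d2 + 4*c2^2*b2*d2 - 8*c2*a1*b2*d2 + 4*a1^2*b2*d2 - 4*c0*a2*b2*d2
    + 8*c0*c1*d1*d2 - 8*c0*c2*d1*d2 - 8*c0*a1*d1*d2 + 8*c0*a2*d1*d2 - 8*c1*a1*d2^2

/-- The leading coefficient of the quadratic polynomial `Q_3`. -/
def coeff32 (a0 a1 a2 b0 b1 b2 c0 c1 c2 d0 d1 d2 : R) : R :=
    4*c1*b0*b1*b2 - 4*c2*b0*b1*b2 + 4*a1*b0*b1*b2 - 4*a2*b0*b1*b2 - 4*c0*b0*b1*d1 + 4*c2*b0*b1*d1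
    + 4*a1*b0*b1*d1 + 4*c0*b1*d1^2 - 4*c1*b1*d1^2 + 4*a2*b1*d1^2 + 4*c0*b0*b2*d2 - 4*c1*b0*b2*d2
    - 4*a2*b0*b2*d2 - 4*c0*d1^2*d2 + 4*c1*d1^2*d2 + 4*a2*d1^2*d2 - 4*c0*b2*d2^2 + 4*c2*b2*d2^2
    - 4*a1*b2*d2^2 + 4*c0*d1*d2^2 - 4*c2*d1*d2^2 - 4*a1*d1*d2^2 + 4*c0*b0*b1 - 4*c1*b0*b1
    - 8*a1*b0*b1 + 4*a2*b0*b1 - 4*c0*b0*b2 + 4*c2*b0*b2 - 4*a1*b0*b2 + 8*a2*b0*b2 - 4*c1*b1*b2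
    + 4*c2*b1*b2 - 4*a1*b1*b2 + 4*a2*b1*b2 + 4*c0*b0*d1 - 4*c2*b0*d1 - 4*a1*b0*d1 - 4*c0*b1*d1
    + 8*c1*b1*d1 - 4*c2*b1*d1 - 4*a1*b1*d1 - 8*a2*b1*d1 - 8*a2*d1^2 - 4*c0*b0*d2 + 4*c1*b0*d2
    + 4*a2*b0*d2 + 4*c0*b2*d2 + 4*c1*b2*d2 - 8*c2*b2*d2 + 8*a1*b2*d2 + 4*a2*b2*d2 - 8*c1*d1*d2
    + 8*c2*d1*d2 + 8*a1*d1*d2 - 8*a2*d1*d2 + 8*a1*d2^2 + 8*a1*b0 - 8*a2*b0 + 8*a1*b1 - 8*a2*b2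
    + 16*a2*d1 - 16*a1*d2

end Coefficients

noncomputable section

/-- Evaluate an expression in twelve quantities at the twelve variables. -/
def atVars (f : Poly → Poly → Poly → Poly → Poly → Poly → Poly → Poly → Poly → Poly →
    Poly → Poly → Poly) : Poly :=
  f (MvPolynomial.X (.a 0)) (MvPolynomial.X (.a 1)) (MvPolynomial.X (.a 2))
    (MvPolynomial.X (.b 0)) (MvPolynomial.X (.b 1)) (MvPolynomial.X (.b 2))
    (MvPolynomial.X (.c 0)) (MvPolynomial.X (.c 1)) (MvPolynomial.X (.c 2))
    (MvPolynomial.X (.d 0)) (MvPolynomial.X (.d 1)) (MvPolynomial.X (.d 2))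

/-- The action of an index permutation on polynomials in the twelve variables. -/
def permPoly (σ : Equiv.Perm (Fin 3)) (f : Poly) : Poly :=
  MvPolynomial.rename (Var.perm σ) f

/-- The coefficients `X_{i,j}` of `Q_i`: those of `Q_1`, `Q_2` come from those of `Q_0` by
exchanging the index `0` with `1`, respectively `2`. -/
def coeffX : Fin 4 → Fin 3 → Poly
  | 0 => ![atVars coeff00, atVars coeff01, atVars coeff02]
  | 1 => fun j => permPoly (Equiv.swap 0 1)
      (![atVars coeff00, atVars coeff01, atVars coeff02] j)
  | 2 => fun j => permPoly (Equiv.swap 0 2)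
      (![atVars coeff00, atVars coeff01, atVars coeff02] j)
  | 3 => ![atVars coeff30, atVars coeff31, atVars coeff32]

/-- The quadratic polynomial `X_{i,2} x² + X_{i,1} x + X_{i,0}` (here `x` stands for `z_i²`). -/
def quad (i : Fin 4) : Polynomial Poly :=
  Polynomial.C (coeffX i 2) * Polynomial.X ^ 2 + Polynomial.C (coeffX i 1) * Polynomial.X
    + Polynomial.C (coeffX i 0)

/-- The transposition used to produce a second quadratic polynomial for `z_i²`. The one for
`i = 3` is a parameter `τ`. -/
def transp (τ : Equiv.Perm (Fin 3)) : Fin 4 → Equiv.Perm (Fin 3) :=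
  ![Equiv.swap 1 2, Equiv.swap 0 2, Equiv.swap 0 1, τ]

/-- `ℓ_i`, as a polynomial in `x = z_i²`: the combination of `Q_i` and of the permuted `Q_i`
in which the quadratic terms cancel. -/
def ell (τ : Equiv.Perm (Fin 3)) (i : Fin 4) : Polynomial Poly :=
  Polynomial.C (permPoly (transp τ i) (coeffX i 2)) * quad i
    - Polynomial.C (coeffX i 2) *
      (Polynomial.C (permPoly (transp τ i) (coeffX i 2)) * Polynomial.X ^ 2
        + Polynomial.C (permPoly (transp τ i) (coeffX i 1)) * Polynomial.X
        + Polynomial.C (permPoly (transp τ i) (coeffX i 0)))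

/-- `ℓ_i` is linear in `z_i²`. -/
theorem ell_eq (τ : Equiv.Perm (Fin 3)) (i : Fin 4) :
    ell τ i = Polynomial.C ((ell τ i).coeff 1) * Polynomial.X
      + Polynomial.C ((ell τ i).coeff 0) := by
  have key : ∀ p q r p' q' r' : Poly, ∀ f : Polynomial Poly,
      f = Polynomial.C p' * (Polynomial.C p * Polynomial.X ^ 2 + Polynomial.C q * Polynomial.X
        + Polynomial.C r) - Polynomial.C p * (Polynomial.C p' * Polynomial.X ^ 2
        + Polynomial.C q' * Polynomial.X + Polynomial.C r') →
      f = Polynomial.C (f.coeff 1) * Polynomial.X + Polynomial.C (f.coeff 0) := by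
    intro p q r p' q' r' f hf
    have h : f = Polynomial.C (p' * q - p * q') * Polynomial.X
        + Polynomial.C (p' * r - p * r') := by
      rw [hf]; simp only [Polynomial.C_sub, Polynomial.C_mul]; ring
    rw [h]; simp [Polynomial.coeff_X, Polynomial.coeff_C]
  exact key _ _ _ _ _ _ _ rfl

/-- A variable as a rational function. -/
def ratVar (v : Var) : RatFun := algebraMap Poly RatFun (MvPolynomial.X v)

/-- `g_{i,i}`: the solution `z_i²` of `ℓ_i = 0`. -/
def gDiag (τ : Equiv.Perm (Fin 3)) (i : Fin 4) : RatFun :=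
  -(algebraMap Poly RatFun ((ell τ i).coeff 0)) / algebraMap Poly RatFun ((ell τ i).coeff 1)

/-- The value of `z_j z_k` from `a_i = b_j z_j² + b_k z_k² - 2 d_i z_j z_k`, where
`j = i + 1` and `k = i + 2` modulo `3`, with `g_{j,j}`, `g_{k,k}` in place of `z_j²`, `z_k²`. -/
def gBase (τ : Equiv.Perm (Fin 3)) (i : Fin 3) : RatFun :=
  (ratVar (.b (i + 1)) * gDiag τ (i + 1).castSucc + ratVar (.b (i + 2)) * gDiag τ (i + 2).castSucc
    - ratVar (.a i)) / (2 * ratVar (.d i))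

/-- The value of `z_i z_3` from `c_i = z_3² + b_i z_i² - 2 z_i z_3`, with `g_{3,3}`, `g_{i,i}`
in place of `z_3²`, `z_i²`. -/
def gApex (τ : Equiv.Perm (Fin 3)) (i : Fin 3) : RatFun :=
  (gDiag τ 3 + ratVar (.b i) * gDiag τ i.castSucc - ratVar (.c i)) / 2

/-- The rational functions `g_{i,j}`. -/
def g (τ : Equiv.Perm (Fin 3)) : Fin 4 → Fin 4 → RatFun :=
  ![![gDiag τ 0, gBase τ 2, gBase τ 1, gApex τ 0],
    ![gBase τ 2, gDiag τ 1, gBase τ 0, gApex τ 1],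
    ![gBase τ 1, gBase τ 0, gDiag τ 2, gApex τ 2],
    ![gApex τ 0, gApex τ 1, gApex τ 2, gDiag τ 3]]

/-- The polynomial obtained from the equation `r = 0` between rational functions by clearing
denominators: the numerator of `r` in lowest terms. Every other polynomial
`h * r` that arises by clearing denominators is a multiple of it. -/
def cleared (r : RatFun) : Poly := IsFractionRing.num Poly r

/-- The denominator, in lowest terms, of a rational function. -/
def denom (r : RatFun) : Poly := (IsFractionRing.den Poly r : Poly)

/-- The point `x` satisfies the polynomial constraints obtained by clearing denominators in
`g_{i,i} g_{j,j} = g_{i,j}²` for `i < j` and `g_{i,j} g_{j,k} = g_{i,k} g_{j,j}` for distinct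
`i, j, k`. -/
def Constraints (τ : Equiv.Perm (Fin 3)) (x : Var → ℝ) : Prop :=
  (∀ i j : Fin 4, i < j →
    MvPolynomial.eval x (cleared (g τ i i * g τ j j - g τ i j ^ 2)) = 0) ∧
  (∀ i j k : Fin 4, i ≠ j → j ≠ k → i ≠ k →
    MvPolynomial.eval x (cleared (g τ i j * g τ j k - g τ i k * g τ j j)) = 0)

/-- The values of `a_i, b_i, c_i, d_i` on a tuple of points `P_i` matched with points `p_i`
(a point `p_i ≠ 0` stands for the line through it and the origin). Indices are cyclic. -/
def coords (P p : Fin 4 → E3) : Var → ℝ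
  | .a i => ‖P (i + 1).castSucc - P (i + 2).castSucc‖ ^ 2
  | .b i => inner ℝ (p i.castSucc) (p i.castSucc) * inner ℝ (p 3) (p 3)
      / inner ℝ (p i.castSucc) (p 3) ^ 2
  | .c i => ‖P i.castSucc - P 3‖ ^ 2
  | .d i => inner ℝ (p (i + 1).castSucc) (p (i + 2).castSucc) * inner ℝ (p 3) (p 3)
      / (inner ℝ (p (i + 1).castSucc) (p 3) * inner ℝ (p (i + 2).castSucc) (p 3))

/-- The rigid transformation `T` solves the perspective problem for the tuple: each `T P_i`
lies on the line spanned by `p_i`. -/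
def IsSolution (P p : Fin 4 → E3) (T : E3 ≃ᵃⁱ[ℝ] E3) : Prop :=
  ∀ i, T (P i) ∈ Submodule.span ℝ {p i}

/-- The perspective problem for the tuple is solvable. -/
def Solvable (P p : Fin 4 → E3) : Prop := ∃ T : E3 ≃ᵃⁱ[ℝ] E3, IsSolution P p T

end

end FourPoint

/-!
Normalise the representatives of the lines to `q_i = (‖p_3‖ / (p_i · p_3)) p_i`. Then
`q_i · q_3 = 1`, `q_i · q_i = b_i` and `q_j · q_k = d_i`, so the system of six equations says that
the points `z_i q_i` have the same mutual distances as the `P_i`.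

*Necessity.* A solution of the perspective problem gives a real solution `z` of the system, but the
rational functions `g_{i,j}` may be undefined at the given point. The system expresses `a` and `c`
as polynomials in the parameters `b, d, z`, so one may work over the function field in these
parameters. There `z_i²` is a common root of `Q_i` and of the permuted `Q_i`
(`SatisfiesSystem.root_quad`), hence a root of `ℓ_i`, and the leading coefficient of `ℓ_i` is
nonzero because it is so at one explicit choice of parameters (`eval_ell_coeff_one_ne_zero`).
So `g_{i,j}` has the value `z_i z_j`, the numerators in the constraints vanish identically in the
parameters, and specialising gives the constraints at every point where the system is solvable
(`SatisfiesSystem.constraints`).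

*Sufficiency.* Under the hypotheses the `g_{i,j}` are defined at the given point, and the
constraints say that the matrix `γ` of their values has rank at most one:
`γ_{i,j} = ε z_i z_j` with `ε = ±1` (`exists_rank_one`). By the definition of the off-diagonal
`g_{i,j}`, the squared distances of the `P_i` are `ε` times those of the `z_i q_i`. If `ε = -1`, all
of these vanish, as they are both nonnegative and nonpositive. In either case the two families of
points are congruent, and a rigid transformation carries one to the other.

Both directions evaluate rational functions at places where a denominator may vanish; this is
handled by `HasValue`, which applies to an arbitrary ring homomorphism from the polynomial ring
to a field.
-/

namespace FourPoint

/-! ### Values of rational functions -/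

section Values

variable {A K : Type*} [CommRing A] [Field K]

/-- The rational function `r` extends to `φ` with value `k`: it is a fraction `n / s` with
`φ s ≠ 0` and `k = φ n / φ s`. For `φ` with kernel `𝔭` this says that `r` lies in the local ring
`A_𝔭` and that `k` is its image under the extension of `φ` to `A_𝔭`. -/
def HasValue (φ : A →+* K) (r : FractionRing A) (k : K) : Prop :=
  ∃ n s : A, φ s ≠ 0 ∧ r * algebraMap A (FractionRing A) s = algebraMap A (FractionRing A) n ∧
    k * φ s = φ n

variable {φ : A →+* K} {r r' : FractionRing A} {k k' : K}

theorem hasValue_algebraMap (φ : A →+* K) (f : A) :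
    HasValue φ (algebraMap A (FractionRing A) f) (φ f) :=
  ⟨f, 1, by simp, by simp, by simp⟩

theorem HasValue.add (h : HasValue φ r k) (h' : HasValue φ r' k') :
    HasValue φ (r + r') (k + k') := by
  obtain ⟨n, s, hs, hr, hk⟩ := h
  obtain ⟨n', s', hs', hr', hk'⟩ := h'
  refine ⟨n * s' + n' * s, s * s', by simp [hs, hs'], ?_, ?_⟩
  · simp only [map_mul, map_add]
    rw [← hr, ← hr']
    ring
  · simp only [map_mul, map_add]
    rw [← hk, ← hk']
    ring

theorem HasValue.sub (h : HasValue φ r k) (h' : HasValue φ r' k') :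
    HasValue φ (r - r') (k - k') := by
  obtain ⟨n, s, hs, hr, hk⟩ := h
  obtain ⟨n', s', hs', hr', hk'⟩ := h'
  refine ⟨n * s' - n' * s, s * s', by simp [hs, hs'], ?_, ?_⟩
  · simp only [map_mul, map_sub]
    rw [← hr, ← hr']
    ring
  · simp only [map_mul, map_sub]
    rw [← hk, ← hk']
    ring

theorem HasValue.mul (h : HasValue φ r k) (h' : HasValue φ r' k') :
    HasValue φ (r * r') (k * k') := by
  obtain ⟨n, s, hs, hr, hk⟩ := h
  obtain ⟨n', s', hs', hr', hk'⟩ := h'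
  refine ⟨n * n', s * s', by simp [hs, hs'], ?_, ?_⟩
  · simp only [map_mul]
    rw [← hr, ← hr']
    ring
  · simp only [map_mul]
    rw [← hk, ← hk']
    ring

variable [IsDomain A]

theorem HasValue.div_algebraMap (h : HasValue φ r k) {f : A} (hf : φ f ≠ 0) :
    HasValue φ (r / algebraMap A (FractionRing A) f) (k / φ f) := by
  obtain ⟨n, s, hs, hr, hk⟩ := h
  have hf' : algebraMap A (FractionRing A) f ≠ 0 := by
    intro h0
    rw [FaithfulSMul.algebraMap_eq_zero_iff] at h0
    exact hf (by simp [h0])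
  refine ⟨n, s * f, by simp [hs, hf], ?_, ?_⟩
  · rw [map_mul, ← hr]
    field_simp
  · rw [map_mul, ← hk]
    field_simp

variable [UniqueFactorizationMonoid A]

/-- The denominator in lowest terms divides every other denominator, so it is not killed by `φ`,
and the value can be computed from the fraction in lowest terms. -/
theorem HasValue.lowest_terms (h : HasValue φ r k) :
    φ (IsFractionRing.den A r) ≠ 0 ∧
      φ (IsFractionRing.num A r) = k * φ (IsFractionRing.den A r) := by
  obtain ⟨n, s, hs, hr, hk⟩ := h
  have hden : algebraMap A (FractionRing A) (IsFractionRing.den A r) ≠ 0 := by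
    rw [Ne, FaithfulSMul.algebraMap_eq_zero_iff]
    exact nonZeroDivisors.ne_zero (IsFractionRing.den A r).2
  have hmul : IsFractionRing.num A r * s = (IsFractionRing.den A r : A) * n := by
    apply FaithfulSMul.algebraMap_injective A (FractionRing A)
    have hr' := (div_eq_iff hden).mp (IsFractionRing.mk'_num_den' A r)
    rw [map_mul, map_mul, ← hr, hr']
    ring
  have hdvd : (IsFractionRing.den A r : A) ∣ s :=
    (IsFractionRing.num_den_reduced A r).symm.dvd_of_dvd_mul_left ⟨n, hmul⟩
  have hd : φ (IsFractionRing.den A r) ≠ 0 := by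
    obtain ⟨t, ht⟩ := hdvd
    intro h0
    exact hs (by rw [ht, map_mul, h0, zero_mul])
  refine ⟨hd, mul_right_cancel₀ hs ?_⟩
  rw [← map_mul, hmul, map_mul, ← hk]
  ring

theorem hasValue_of_den_ne_zero (h : φ (IsFractionRing.den A r) ≠ 0) :
    HasValue φ r (φ (IsFractionRing.num A r) / φ (IsFractionRing.den A r)) := by
  refine ⟨_, _, h, ?_, div_mul_cancel₀ _ h⟩
  have hden : algebraMap A (FractionRing A) (IsFractionRing.den A r) ≠ 0 := by
    rw [Ne, FaithfulSMul.algebraMap_eq_zero_iff]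
    exact nonZeroDivisors.ne_zero (IsFractionRing.den A r).2
  exact ((div_eq_iff hden).mp (IsFractionRing.mk'_num_den' A r)).symm

theorem HasValue.num_eq_zero_iff (h : HasValue φ r k) :
    φ (IsFractionRing.num A r) = 0 ↔ k = 0 := by
  rw [h.lowest_terms.2, mul_eq_zero, or_iff_left h.lowest_terms.1]

end Values

/-! ### The six equations and the quadratic polynomials -/

section System

variable {R : Type*}

/-- Permute the unknowns `z_0, z_1, z_2` and keep `z_3`. -/
def permUnknowns (σ : Equiv.Perm (Fin 3)) (z : Fin 4 → R) : Fin 4 → R :=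
  Fin.snoc (α := fun _ => R) (fun i => z (σ i).castSucc) (z 3)

@[simp]
theorem permUnknowns_castSucc (σ : Equiv.Perm (Fin 3)) (z : Fin 4 → R) (i : Fin 3) :
    permUnknowns σ z i.castSucc = z (σ i).castSucc :=
  Fin.snoc_castSucc (α := fun _ => R) _ _ _

@[simp]
theorem permUnknowns_three (σ : Equiv.Perm (Fin 3)) (z : Fin 4 → R) :
    permUnknowns σ z 3 = z 3 :=
  Fin.snoc_last (α := fun _ => R) _ _

theorem permUnknowns_transp (τ : Equiv.Perm (Fin 3)) (z : Fin 4 → R) (i : Fin 4) :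
    permUnknowns (transp τ i) z i = z i := by
  fin_cases i <;> rfl

variable [CommRing R]

/-- The six equations between the twelve quantities `x` and the unknowns `z`. -/
def SatisfiesSystem (x : Var → R) (z : Fin 4 → R) : Prop :=
  ∀ i : Fin 3,
    x (.a i) = x (.b (i + 1)) * z (i + 1).castSucc ^ 2 + x (.b (i + 2)) * z (i + 2).castSucc ^ 2
      - 2 * x (.d i) * z (i + 1).castSucc * z (i + 2).castSucc ∧
    x (.c i) = z 3 ^ 2 + x (.b i) * z i.castSucc ^ 2 - 2 * z i.castSucc * z 3

/-- The system is symmetric in the indices `0, 1, 2`. -/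
theorem SatisfiesSystem.perm {x : Var → R} {z : Fin 4 → R} (h : SatisfiesSystem x z)
    (σ : Equiv.Perm (Fin 3)) : SatisfiesSystem (x ∘ Var.perm σ) (permUnknowns σ z) := by
  intro i
  have hσ : ∀ (σ : Equiv.Perm (Fin 3)) (i : Fin 3),
      (σ (i + 1) = σ i + 1 ∧ σ (i + 2) = σ i + 2) ∨
        (σ (i + 1) = σ i + 2 ∧ σ (i + 2) = σ i + 1) := by decide
  obtain ⟨ha, hc⟩ := h (σ i)
  simp only [Function.comp_apply, Var.perm, permUnknowns_castSucc, permUnknowns_three]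
  refine ⟨?_, hc⟩
  rcases hσ σ i with ⟨h1, h2⟩ | ⟨h1, h2⟩ <;> rw [h1, h2, ha]
  ring

/-- `Q_0(z_0²)` lies in the ideal of the system. -/
theorem coeff0_root {a0 a1 a2 b0 b1 b2 c0 c1 : R} (c2 : R) {d0 d1 d2 z0 z1 z2 z3 : R}
    (ha0 : a0 = b1 * z1 ^ 2 + b2 * z2 ^ 2 - 2 * d0 * z1 * z2)
    (ha1 : a1 = b2 * z2 ^ 2 + b0 * z0 ^ 2 - 2 * d1 * z2 * z0)
    (ha2 : a2 = b0 * z0 ^ 2 + b1 * z1 ^ 2 - 2 * d2 * z0 * z1)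
    (hc0 : c0 = z3 ^ 2 + b0 * z0 ^ 2 - 2 * z0 * z3)
    (hc1 : c1 = z3 ^ 2 + b1 * z1 ^ 2 - 2 * z1 * z3) :
    coeff02 a0 a1 a2 b0 b1 b2 c0 c1 c2 d0 d1 d2 * (z0 ^ 2) ^ 2
      + coeff01 a0 a1 a2 b0 b1 b2 c0 c1 c2 d0 d1 d2 * z0 ^ 2
      + coeff00 a0 a1 a2 b0 b1 b2 c0 c1 c2 d0 d1 d2 = 0 := by
  subst ha0 ha1 ha2 hc0 hc1
  unfold coeff02 coeff01 coeff00
  ring1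

/-- `Q_3(z_3²)` lies in the ideal of the system. -/
theorem coeff3_root (a0 : R) {a1 a2 b0 b1 b2 c0 c1 c2 : R} (d0 : R) {d1 d2 z0 z1 z2 z3 : R}
    (ha1 : a1 = b2 * z2 ^ 2 + b0 * z0 ^ 2 - 2 * d1 * z2 * z0)
    (ha2 : a2 = b0 * z0 ^ 2 + b1 * z1 ^ 2 - 2 * d2 * z0 * z1)
    (hc0 : c0 = z3 ^ 2 + b0 * z0 ^ 2 - 2 * z0 * z3)
    (hc1 : c1 = z3 ^ 2 + b1 * z1 ^ 2 - 2 * z1 * z3)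
    (hc2 : c2 = z3 ^ 2 + b2 * z2 ^ 2 - 2 * z2 * z3) :
    coeff32 a0 a1 a2 b0 b1 b2 c0 c1 c2 d0 d1 d2 * (z3 ^ 2) ^ 2
      + coeff31 a0 a1 a2 b0 b1 b2 c0 c1 c2 d0 d1 d2 * z3 ^ 2
      + coeff30 a0 a1 a2 b0 b1 b2 c0 c1 c2 d0 d1 d2 = 0 := by
  subst ha1 ha2 hc0 hc1 hc2
  unfold coeff32 coeff31 coeff30
  ring1

/-- Evaluate an expression in twelve quantities at the values `x`. -/
def atPoint (f : R → R → R → R → R → R → R → R → R → R → R → R → R) (x : Var → R) : R :=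
  f (x (.a 0)) (x (.a 1)) (x (.a 2)) (x (.b 0)) (x (.b 1)) (x (.b 2))
    (x (.c 0)) (x (.c 1)) (x (.c 2)) (x (.d 0)) (x (.d 1)) (x (.d 2))

/-- The values of the coefficients `X_{i,j}` at `x`. -/
def coeffAt (x : Var → R) : Fin 4 → Fin 3 → R
  | 0 => ![atPoint coeff00 x, atPoint coeff01 x, atPoint coeff02 x]
  | 1 => ![atPoint coeff00 (x ∘ Var.perm (Equiv.swap 0 1)),
      atPoint coeff01 (x ∘ Var.perm (Equiv.swap 0 1)),
      atPoint coeff02 (x ∘ Var.perm (Equiv.swap 0 1))]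
  | 2 => ![atPoint coeff00 (x ∘ Var.perm (Equiv.swap 0 2)),
      atPoint coeff01 (x ∘ Var.perm (Equiv.swap 0 2)),
      atPoint coeff02 (x ∘ Var.perm (Equiv.swap 0 2))]
  | 3 => ![atPoint coeff30 x, atPoint coeff31 x, atPoint coeff32 x]

theorem map_atVars_coeff (φ : Poly →+* R) :
    (φ (atVars coeff00) = atPoint coeff00 (fun v => φ (MvPolynomial.X v)) ∧
      φ (atVars coeff01) = atPoint coeff01 (fun v => φ (MvPolynomial.X v)) ∧
      φ (atVars coeff02) = atPoint coeff02 (fun v => φ (MvPolynomial.X v))) ∧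
    φ (atVars coeff30) = atPoint coeff30 (fun v => φ (MvPolynomial.X v)) ∧
      φ (atVars coeff31) = atPoint coeff31 (fun v => φ (MvPolynomial.X v)) ∧
      φ (atVars coeff32) = atPoint coeff32 (fun v => φ (MvPolynomial.X v)) := by
  refine ⟨⟨?_, ?_, ?_⟩, ?_, ?_, ?_⟩ <;>
  simp only [atVars, atPoint, coeff00, coeff01, coeff02, coeff30, coeff31, coeff32, map_add,
    map_sub, map_mul, map_pow, map_neg, map_ofNat]

/-- Applying a ring homomorphism after an index permutation amounts to permuting the values. -/
theorem map_permPoly (φ : Poly →+* R) (σ : Equiv.Perm (Fin 3)) :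
    ∃ ψ : Poly →+* R, (∀ f, φ (permPoly σ f) = ψ f) ∧
      (fun v => ψ (MvPolynomial.X v)) = (fun v => φ (MvPolynomial.X v)) ∘ Var.perm σ := by
  refine ⟨φ.comp (MvPolynomial.rename (R := ℝ) (Var.perm σ)).toRingHom, fun f => rfl, ?_⟩
  funext v
  simp

theorem map_coeffX (φ : Poly →+* R) (i : Fin 4) (j : Fin 3) :
    φ (coeffX i j) = coeffAt (fun v => φ (MvPolynomial.X v)) i j := by
  have key : ∀ (ψ : Poly →+* R) (j : Fin 3),
      ψ (![atVars coeff00, atVars coeff01, atVars coeff02] j) =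
        (![atPoint coeff00 (fun v => ψ (MvPolynomial.X v)),
          atPoint coeff01 (fun v => ψ (MvPolynomial.X v)),
          atPoint coeff02 (fun v => ψ (MvPolynomial.X v))] : Fin 3 → R) j := by
    intro ψ j
    obtain ⟨⟨h0, h1, h2⟩, -⟩ := map_atVars_coeff ψ
    fin_cases j
    exacts [h0, h1, h2]
  have keyPerm : ∀ (σ : Equiv.Perm (Fin 3)) (j : Fin 3),
      φ (permPoly σ (![atVars coeff00, atVars coeff01, atVars coeff02] j)) =
        (![atPoint coeff00 ((fun v => φ (MvPolynomial.X v)) ∘ Var.perm σ),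
          atPoint coeff01 ((fun v => φ (MvPolynomial.X v)) ∘ Var.perm σ),
          atPoint coeff02 ((fun v => φ (MvPolynomial.X v)) ∘ Var.perm σ)] : Fin 3 → R) j := by
    intro σ j
    obtain ⟨ψ, hψ, hX⟩ := map_permPoly φ σ
    rw [hψ, key, hX]
  fin_cases i
  · exact key φ j
  · exact keyPerm _ j
  · exact keyPerm _ j
  · obtain ⟨-, h0, h1, h2⟩ := map_atVars_coeff φ
    fin_cases j
    exacts [h0, h1, h2]

theorem map_permPoly_coeffX (φ : Poly →+* R) (σ : Equiv.Perm (Fin 3)) (i : Fin 4) (j : Fin 3) :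
    φ (permPoly σ (coeffX i j)) =
      coeffAt ((fun v => φ (MvPolynomial.X v)) ∘ Var.perm σ) i j := by
  obtain ⟨ψ, hψ, hX⟩ := map_permPoly φ σ
  rw [hψ, map_coeffX, hX]

/-- On every solution of the system, `z_i²` is a root of `Q_i`. -/
theorem SatisfiesSystem.root_quad {x : Var → R} {z : Fin 4 → R} (h : SatisfiesSystem x z)
    (i : Fin 4) :
    coeffAt x i 2 * (z i ^ 2) ^ 2 + coeffAt x i 1 * z i ^ 2 + coeffAt x i 0 = 0 := by
  have key : ∀ {x : Var → R} {z : Fin 4 → R}, SatisfiesSystem x z →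
      atPoint coeff02 x * (z 0 ^ 2) ^ 2 + atPoint coeff01 x * z 0 ^ 2 + atPoint coeff00 x = 0 := by
    intro x z h
    exact coeff0_root _ (h 0).1 (h 1).1 (h 2).1 (h 0).2 (h 1).2
  fin_cases i
  · exact key h
  · exact key (h.perm (Equiv.swap 0 1))
  · exact key (h.perm (Equiv.swap 0 2))
  · exact coeff3_root (x (.a 0)) (x (.d 0)) (h 1).1 (h 2).1 (h 0).2 (h 1).2 (h 2).2

theorem ell_coeff_one (τ : Equiv.Perm (Fin 3)) (i : Fin 4) :
    (ell τ i).coeff 1 = permPoly (transp τ i) (coeffX i 2) * coeffX i 1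
      - coeffX i 2 * permPoly (transp τ i) (coeffX i 1) := by
  simp [ell, quad, Polynomial.coeff_C]

theorem ell_coeff_zero (τ : Equiv.Perm (Fin 3)) (i : Fin 4) :
    (ell τ i).coeff 0 = permPoly (transp τ i) (coeffX i 2) * coeffX i 0
      - coeffX i 2 * permPoly (transp τ i) (coeffX i 0) := by
  simp [ell, quad]

theorem map_ell_coeff_one (φ : Poly →+* R) (τ : Equiv.Perm (Fin 3)) (i : Fin 4) :
    φ ((ell τ i).coeff 1) =
      coeffAt ((fun v => φ (MvPolynomial.X v)) ∘ Var.perm (transp τ i)) i 2 *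
          coeffAt (fun v => φ (MvPolynomial.X v)) i 1
        - coeffAt (fun v => φ (MvPolynomial.X v)) i 2 *
          coeffAt ((fun v => φ (MvPolynomial.X v)) ∘ Var.perm (transp τ i)) i 1 := by
  rw [ell_coeff_one, map_sub, map_mul, map_mul, map_permPoly_coeffX, map_permPoly_coeffX,
    map_coeffX, map_coeffX]

theorem map_ell_coeff_zero (φ : Poly →+* R) (τ : Equiv.Perm (Fin 3)) (i : Fin 4) :
    φ ((ell τ i).coeff 0) =
      coeffAt ((fun v => φ (MvPolynomial.X v)) ∘ Var.perm (transp τ i)) i 2 *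
          coeffAt (fun v => φ (MvPolynomial.X v)) i 0
        - coeffAt (fun v => φ (MvPolynomial.X v)) i 2 *
          coeffAt ((fun v => φ (MvPolynomial.X v)) ∘ Var.perm (transp τ i)) i 0 := by
  rw [ell_coeff_zero, map_sub, map_mul, map_mul, map_permPoly_coeffX, map_permPoly_coeffX,
    map_coeffX, map_coeffX]

/-- On every solution of the system, `z_i²` is a root of `ℓ_i`: it is a root of `Q_i` and of the
permuted `Q_i`, because the permutation fixes the index `i`. -/
theorem SatisfiesSystem.root_ell {φ : Poly →+* R} {z : Fin 4 → R}
    (h : SatisfiesSystem (fun v => φ (MvPolynomial.X v)) z) (τ : Equiv.Perm (Fin 3)) (i : Fin 4) :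
    φ ((ell τ i).coeff 1) * z i ^ 2 + φ ((ell τ i).coeff 0) = 0 := by
  have h1 := h.root_quad i
  have h2 := (h.perm (transp τ i)).root_quad i
  rw [permUnknowns_transp] at h2
  rw [map_ell_coeff_one, map_ell_coeff_zero]
  linear_combination
    coeffAt ((fun v => φ (MvPolynomial.X v)) ∘ Var.perm (transp τ i)) i 2 * h1
      - coeffAt (fun v => φ (MvPolynomial.X v)) i 2 * h2

end System

/-! ### Values of the `g_{i,j}` -/

section GValues

variable {K : Type*} [Field K]

/-- The matrix with diagonal `γ` and off-diagonal entries computed from the equations of the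
system, at the point `x`. -/
def gValue (x : Var → K) (γ : Fin 4 → K) : Fin 4 → Fin 4 → K :=
  let base (i : Fin 3) : K := (x (.b (i + 1)) * γ (i + 1).castSucc
    + x (.b (i + 2)) * γ (i + 2).castSucc - x (.a i)) / (2 * x (.d i))
  let apex (i : Fin 3) : K := (γ 3 + x (.b i) * γ i.castSucc - x (.c i)) / 2
  ![![γ 0, base 2, base 1, apex 0],
    ![base 2, γ 1, base 0, apex 1],
    ![base 1, base 0, γ 2, apex 2],
    ![apex 0, apex 1, apex 2, γ 3]]

theorem hasValue_g {φ : Poly →+* K} (h2 : (2 : K) ≠ 0)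
    (hd : ∀ i, φ (MvPolynomial.X (.d i)) ≠ 0) {τ : Equiv.Perm (Fin 3)} {γ : Fin 4 → K}
    (hγ : ∀ i, HasValue φ (gDiag τ i) (γ i)) (i j : Fin 4) :
    HasValue φ (g τ i j) (gValue (fun v => φ (MvPolynomial.X v)) γ i j) := by
  have hX : ∀ v, HasValue φ (ratVar v) (φ (MvPolynomial.X v)) := fun v => hasValue_algebraMap φ _
  have base : ∀ i : Fin 3, HasValue φ (gBase τ i)
      ((φ (MvPolynomial.X (.b (i + 1))) * γ (i + 1).castSucc
        + φ (MvPolynomial.X (.b (i + 2))) * γ (i + 2).castSucc - φ (MvPolynomial.X (.a i)))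
          / (2 * φ (MvPolynomial.X (.d i)))) := by
    intro i
    have h := ((((hX (.b (i + 1))).mul (hγ (i + 1).castSucc)).add
      ((hX (.b (i + 2))).mul (hγ (i + 2).castSucc))).sub (hX (.a i))).div_algebraMap
        (f := 2 * MvPolynomial.X (.d i)) (by rw [map_mul, map_ofNat]; exact mul_ne_zero h2 (hd i))
    simpa only [gBase, ratVar, map_mul, map_ofNat] using h
  have apex : ∀ i : Fin 3, HasValue φ (gApex τ i)
      ((γ 3 + φ (MvPolynomial.X (.b i)) * γ i.castSucc - φ (MvPolynomial.X (.c i))) / 2) := by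
    intro i
    have h := (((hγ 3).add ((hX (.b i)).mul (hγ i.castSucc))).sub (hX (.c i))).div_algebraMap
        (f := 2) (by rwa [map_ofNat])
    simpa only [gApex, ratVar, map_ofNat] using h
  fin_cases i <;> fin_cases j
  exacts [hγ 0, base 2, base 1, apex 0, base 2, hγ 1, base 0, apex 1,
    base 1, base 0, hγ 2, apex 2, apex 0, apex 1, apex 2, hγ 3]

theorem gValue_diag (x : Var → K) (γ : Fin 4 → K) (i : Fin 4) : gValue x γ i i = γ i := by
  fin_cases i <;> rfl

theorem gValue_symm (x : Var → K) (γ : Fin 4 → K) (i j : Fin 4) :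
    gValue x γ i j = gValue x γ j i := by
  fin_cases i <;> fin_cases j <;> rfl

/-- By construction the entries of the matrix solve the linearised system. -/
theorem gValue_linear_system {x : Var → K} {γ : Fin 4 → K} (h2 : (2 : K) ≠ 0)
    (hd : ∀ i, x (.d i) ≠ 0) (i : Fin 3) :
    x (.a i) = x (.b (i + 1)) * γ (i + 1).castSucc + x (.b (i + 2)) * γ (i + 2).castSucc
      - 2 * x (.d i) * gValue x γ (i + 1).castSucc (i + 2).castSucc ∧
    x (.c i) = γ 3 + x (.b i) * γ i.castSucc - 2 * gValue x γ i.castSucc 3 := by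
  have hb : gValue x γ (i + 1).castSucc (i + 2).castSucc = (x (.b (i + 1)) * γ (i + 1).castSucc
      + x (.b (i + 2)) * γ (i + 2).castSucc - x (.a i)) / (2 * x (.d i)) := by
    fin_cases i <;> rfl
  have ha : gValue x γ i.castSucc 3 = (γ 3 + x (.b i) * γ i.castSucc - x (.c i)) / 2 := by
    fin_cases i <;> rfl
  have := hd i
  rw [hb, ha]
  constructor <;> field_simp <;> ring

theorem SatisfiesSystem.gValue_eq {x : Var → K} {z : Fin 4 → K} (h : SatisfiesSystem x z)
    (h2 : (2 : K) ≠ 0) (hd : ∀ i, x (.d i) ≠ 0) (i j : Fin 4) :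
    gValue x (fun i => z i ^ 2) i j = z i * z j := by
  have base : ∀ i : Fin 3, gValue x (fun i => z i ^ 2) (i + 1).castSucc (i + 2).castSucc =
      z (i + 1).castSucc * z (i + 2).castSucc := by
    intro i
    have h' := (gValue_linear_system (γ := fun i => z i ^ 2) h2 hd i).1
    rw [(h i).1] at h'
    apply mul_left_cancel₀ (mul_ne_zero h2 (hd i))
    linear_combination h'
  have apex : ∀ i : Fin 3, gValue x (fun i => z i ^ 2) i.castSucc 3 = z i.castSucc * z 3 := by
    intro i
    have h' := (gValue_linear_system (γ := fun i => z i ^ 2) h2 hd i).2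
    rw [(h i).2] at h'
    apply mul_left_cancel₀ h2
    linear_combination h'
  have diag : ∀ i, gValue x (fun i => z i ^ 2) i i = z i * z i :=
    fun i => (gValue_diag _ _ _).trans (sq _)
  have symm : ∀ {i j}, gValue x (fun i => z i ^ 2) i j = z i * z j →
      gValue x (fun i => z i ^ 2) j i = z j * z i :=
    fun h => (gValue_symm _ _ _ _).trans (h.trans (mul_comm _ _))
  fin_cases i <;> fin_cases j
  exacts [diag 0, base 2, symm (base 1), apex 0, symm (base 2), diag 1, base 0, apex 1,
    base 1, symm (base 0), diag 2, apex 2, symm (apex 0), symm (apex 1), symm (apex 2), diag 3]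

end GValues

/-! ### The generic solution -/

section Generic

variable {R S : Type*} [CommRing R] [CommRing S]

/-- The point with parameters `b`, `d` for which `z` solves the system. -/
def modelPoint (b d : Fin 3 → R) (z : Fin 4 → R) : Var → R
  | .a i => b (i + 1) * z (i + 1).castSucc ^ 2 + b (i + 2) * z (i + 2).castSucc ^ 2
      - 2 * d i * z (i + 1).castSucc * z (i + 2).castSucc
  | .b i => b i
  | .c i => z 3 ^ 2 + b i * z i.castSucc ^ 2 - 2 * z i.castSucc * z 3
  | .d i => d i

theorem satisfiesSystem_modelPoint (b d : Fin 3 → R) (z : Fin 4 → R) :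
    SatisfiesSystem (modelPoint b d z) z :=
  fun _ => ⟨rfl, rfl⟩

theorem SatisfiesSystem.eq_modelPoint {x : Var → R} {z : Fin 4 → R} (h : SatisfiesSystem x z) :
    x = modelPoint (fun i => x (.b i)) (fun i => x (.d i)) z := by
  funext v
  rcases v with i | i | i | i
  exacts [(h i).1, rfl, (h i).2, rfl]

theorem map_modelPoint (f : R →+* S) (b d : Fin 3 → R) (z : Fin 4 → R) (v : Var) :
    f (modelPoint b d z v) = modelPoint (f ∘ b) (f ∘ d) (f ∘ z) v := by
  rcases v with i | i | i | i <;>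
  simp only [modelPoint, map_add, map_sub, map_mul, map_pow, map_ofNat, Function.comp_apply]

/-- The coordinate ring of the space of the parameters `b`, `d`, `z`. -/
abbrev ParamRing : Type := MvPolynomial (Fin 3 ⊕ Fin 3 ⊕ Fin 4) ℝ

/-- Substitution of the generic solution of the system for the twelve variables. -/
noncomputable def genericSubst : Poly →+* ParamRing :=
  MvPolynomial.eval₂Hom MvPolynomial.C (modelPoint (fun i => MvPolynomial.X (.inl i))
    (fun i => MvPolynomial.X (.inr (.inl i))) (fun i => MvPolynomial.X (.inr (.inr i))))

theorem genericSubst_X (v : Var) : genericSubst (MvPolynomial.X v) =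
    modelPoint (fun i => MvPolynomial.X (.inl i))
      (fun i => MvPolynomial.X (.inr (.inl i))) (fun i => MvPolynomial.X (.inr (.inr i))) v :=
  MvPolynomial.eval₂Hom_X' _ _ _

/-- Specialising the generic solution to given parameters. -/
theorem eval_genericSubst (b d : Fin 3 → ℝ) (z : Fin 4 → ℝ) (f : Poly) :
    MvPolynomial.eval (Sum.elim b (Sum.elim d z)) (genericSubst f) =
      MvPolynomial.eval (modelPoint b d z) f := by
  suffices h : (MvPolynomial.eval (Sum.elim b (Sum.elim d z))).comp genericSubst =
      MvPolynomial.eval (modelPoint b d z) from congrArg (fun φ : Poly →+* ℝ => φ f) h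
  apply MvPolynomial.ringHom_ext
  · intro r
    simp [genericSubst]
  · intro v
    rw [RingHom.comp_apply, genericSubst_X, map_modelPoint, MvPolynomial.eval_X]
    congr 1 <;> funext i <;> simp

/-- At this specialisation of the generic solution no `ℓ_i` has vanishing leading coefficient; hence
the leading coefficients do not vanish on the generic solution. -/
theorem eval_ell_coeff_one_ne_zero {τ : Equiv.Perm (Fin 3)}
    (hτ : τ = Equiv.swap 0 1 ∨ τ = Equiv.swap 0 2) (i : Fin 4) :
    MvPolynomial.eval (modelPoint ![1, 0, 0] ![-1, 1, -1] ![-1, 0, 1, 0])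
      ((ell τ i).coeff 1) ≠ 0 := by
  set x : Var → ℝ := modelPoint ![1, 0, 0] ![-1, 1, -1] ![-1, 0, 1, 0] with hx
  have ha0 : x (.a 0) = 0 := by simp [hx, modelPoint]
  have ha1 : x (.a 1) = 3 := by simp [hx, modelPoint]; norm_num
  have ha2 : x (.a 2) = 1 := by simp [hx, modelPoint]
  have hb0 : x (.b 0) = 1 := by simp [hx, modelPoint]
  have hb1 : x (.b 1) = 0 := by simp [hx, modelPoint]
  have hb2 : x (.b 2) = 0 := by simp [hx, modelPoint]
  have hc0 : x (.c 0) = 1 := by simp [hx, modelPoint]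
  have hc1 : x (.c 1) = 0 := by simp [hx, modelPoint]
  have hc2 : x (.c 2) = 0 := by simp [hx, modelPoint]
  have hd0 : x (.d 0) = -1 := by simp [hx, modelPoint]
  have hd1 : x (.d 1) = 1 := by simp [hx, modelPoint]
  have hd2 : x (.d 2) = -1 := by simp [hx, modelPoint]
  clear_value x
  have s01 : Equiv.swap (0 : Fin 3) 1 2 = 2 := by decide
  have s02 : Equiv.swap (0 : Fin 3) 2 1 = 1 := by decide
  have s12 : Equiv.swap (1 : Fin 3) 2 0 = 0 := by decide
  have v2 : ∀ u v w : ℝ, ![u, v, w] 2 = w := fun _ _ _ => rfl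
  rw [map_ell_coeff_one]
  simp only [MvPolynomial.eval_X]
  rcases hτ with rfl | rfl <;> fin_cases i <;>
  norm_num [coeffAt, atPoint, transp, Var.perm, coeff01, coeff02, coeff31, coeff32, v2, s01, s02,
    s12, ha0, ha1, ha2, hb0, hb1, hb2, hc0, hc1, hc2, hd0, hd1, hd2]

/-- The constraints hold at every point at which the system has a solution. They hold for the
generic solution, where all denominators are nonzero, and hence for each of its specialisations,
including those at which some of the denominators vanish. -/
theorem SatisfiesSystem.constraints {τ : Equiv.Perm (Fin 3)}
    (hτ : τ = Equiv.swap 0 1 ∨ τ = Equiv.swap 0 2) {x : Var → ℝ} {z : Fin 4 → ℝ}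
    (h : SatisfiesSystem x z) : Constraints τ x := by
  set φ : Poly →+* FractionRing ParamRing :=
    (algebraMap ParamRing (FractionRing ParamRing)).comp genericSubst with hφ
  set Z : Fin 4 → FractionRing ParamRing := fun i =>
    algebraMap ParamRing (FractionRing ParamRing) (MvPolynomial.X (.inr (.inr i))) with hZ
  have hinj : ∀ f, φ f = 0 ↔ genericSubst f = 0 := fun f => by
    rw [hφ, RingHom.comp_apply, FaithfulSMul.algebraMap_eq_zero_iff]
  have hsys : SatisfiesSystem (fun v => φ (MvPolynomial.X v)) Z := by
    have : (fun v => φ (MvPolynomial.X v)) = modelPoint _ _ Z := funext fun v => by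
      rw [hφ, RingHom.comp_apply, genericSubst_X, map_modelPoint]
      rfl
    rw [this]
    exact satisfiesSystem_modelPoint _ _ _
  have h2 : (2 : FractionRing ParamRing) ≠ 0 := by
    have : φ 2 ≠ 0 := by
      rw [Ne, hinj, map_ofNat]
      exact two_ne_zero
    rwa [map_ofNat] at this
  have hd : ∀ i, φ (MvPolynomial.X (.d i)) ≠ 0 := fun i => by
    rw [Ne, hinj, genericSubst_X]
    exact MvPolynomial.X_ne_zero _
  have hell : ∀ i, φ ((ell τ i).coeff 1) ≠ 0 := by
    intro i h0
    rw [hinj] at h0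
    apply eval_ell_coeff_one_ne_zero hτ i
    rw [← eval_genericSubst, h0, map_zero]
  have hdiag : ∀ i, HasValue φ (gDiag τ i) (Z i ^ 2) := by
    intro i
    have hv := (hasValue_algebraMap φ (-(ell τ i).coeff 0)).div_algebraMap (hell i)
    have hz : φ (-(ell τ i).coeff 0) / φ ((ell τ i).coeff 1) = Z i ^ 2 := by
      rw [div_eq_iff (hell i), map_neg]
      linear_combination -hsys.root_ell τ i
    rwa [hz, map_neg] at hv
  have hg : ∀ i j, HasValue φ (g τ i j) (Z i * Z j) := by
    intro i j
    rw [← hsys.gValue_eq h2 hd]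
    exact hasValue_g h2 hd hdiag i j
  have key : ∀ r : RatFun, HasValue φ r 0 → MvPolynomial.eval x (cleared r) = 0 := by
    intro r hr
    have h0 := (hinj _).mp (hr.num_eq_zero_iff.mpr rfl)
    rw [h.eq_modelPoint, ← eval_genericSubst, cleared, h0, map_zero]
  constructor
  · intro i j _
    apply key
    convert ((hg i i).mul (hg j j)).sub ((hg i j).mul (hg i j)) using 1 <;> ring
  · intro i j k _ _ _
    apply key
    convert ((hg i j).mul (hg j k)).sub ((hg i k).mul (hg j j)) using 1
    ring

end Generic

/-! ### Rank one matrices -/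

/-- A real symmetric `4 × 4` matrix whose minors of the two given kinds vanish has rank at most
one, so it is plus or minus the square of a vector. -/
theorem exists_rank_one {γ : Fin 4 → Fin 4 → ℝ} (hsymm : ∀ i j, γ i j = γ j i)
    (h1 : ∀ i j, i < j → γ i i * γ j j = γ i j ^ 2)
    (h2 : ∀ i j k, i ≠ j → j ≠ k → i ≠ k → γ i j * γ j k = γ i k * γ j j) :
    ∃ (ε : ℝ) (z : Fin 4 → ℝ), (ε = 1 ∨ ε = -1) ∧ ∀ i j, γ i j = ε * (z i * z j) := by
  have h1' : ∀ i j, γ i i * γ j j = γ i j ^ 2 := by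
    intro i j
    rcases lt_trichotomy i j with h | rfl | h
    · exact h1 i j h
    · ring
    · rw [hsymm i j, ← h1 j i h, mul_comm]
  have h2' : ∀ i j k, γ i j * γ j k = γ i k * γ j j := by
    intro i j k
    by_cases hij : i = j
    · subst hij; ring
    by_cases hjk : j = k
    · subst hjk; ring
    by_cases hik : i = k
    · subst hik
      rw [hsymm j i, h1' i j]; ring
    exact h2 i j k hij hjk hik
  by_cases h0 : ∀ k, γ k k = 0
  · refine ⟨1, fun _ => 0, Or.inl rfl, fun i j => ?_⟩
    have := h1' i j
    rw [h0, zero_mul] at this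
    simpa using this.symm
  push Not at h0
  obtain ⟨k, hk⟩ := h0
  -- The vector is the `k`-th row of the matrix, scaled so that its `k`-th entry is `√|γ k k|`.
  have hs : Real.sqrt |γ k k| ^ 2 = |γ k k| := Real.sq_sqrt (abs_nonneg _)
  have hs0 : Real.sqrt |γ k k| ≠ 0 := Real.sqrt_ne_zero'.mpr (abs_pos.mpr hk)
  have hz : ∀ i j, γ i k / Real.sqrt |γ k k| * (γ j k / Real.sqrt |γ k k|) =
      γ i j * γ k k / |γ k k| := by
    intro i j
    rw [div_mul_div_comm, ← sq, hs, hsymm j k, h2']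
  rcases lt_or_gt_of_ne hk with hneg | hpos
  · refine ⟨-1, fun i => γ i k / Real.sqrt |γ k k|, Or.inr rfl, fun i j => ?_⟩
    rw [hz, abs_of_neg hneg]
    field_simp
  · refine ⟨1, fun i => γ i k / Real.sqrt |γ k k|, Or.inl rfl, fun i j => ?_⟩
    rw [hz, abs_of_pos hpos]
    field_simp

/-! ### Congruent families of points -/

section Congruence

variable {ι V : Type*} [Fintype ι] [NormedAddCommGroup V] [InnerProductSpace ℝ V]
  [FiniteDimensional ℝ V]

/-- Two families of vectors with the same Gram matrix differ by a linear isometry. -/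
theorem exists_linearIsometryEquiv_of_inner_eq {u v : ι → V}
    (h : ∀ i j, inner ℝ (u i) (u j) = inner ℝ (v i) (v j)) :
    ∃ E : V ≃ₗᵢ[ℝ] V, ∀ i, E (u i) = v i := by
  classical
  set F : (ι → ℝ) →ₗ[ℝ] V := Fintype.linearCombination ℝ u with hF
  set G : (ι → ℝ) →ₗ[ℝ] V := Fintype.linearCombination ℝ v with hG
  have hnorm : ∀ c, ‖F c‖ = ‖G c‖ := by
    intro c
    rw [← sq_eq_sq₀ (norm_nonneg _) (norm_nonneg _), ← real_inner_self_eq_norm_sq,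
      ← real_inner_self_eq_norm_sq]
    simp only [hF, hG, Fintype.linearCombination_apply, sum_inner, inner_sum,
      real_inner_smul_left, real_inner_smul_right, h]
  have hker : LinearMap.ker F ≤ LinearMap.ker G := by
    intro c hc
    rw [LinearMap.mem_ker] at hc ⊢
    rw [← norm_eq_zero, ← hnorm, hc, norm_zero]
  -- `G` factors through the range of `F`, as an isometry.
  set L : LinearMap.range F →ₗ[ℝ] V :=
    ((LinearMap.ker F).liftQ G hker) ∘ₗ F.quotKerEquivRange.symm.toLinearMap with hL
  have hLF : ∀ c, L ⟨F c, LinearMap.mem_range_self F c⟩ = G c := by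
    intro c
    have : F.quotKerEquivRange.symm ⟨F c, LinearMap.mem_range_self F c⟩ =
        (LinearMap.ker F).mkQ c := F.quotKerEquivRange_symm_apply_image c _
    simp [hL, this]
  have hLnorm : ∀ y, ‖L y‖ = ‖y‖ := by
    rintro ⟨_, c, rfl⟩
    rw [hLF]
    exact (hnorm c).symm
  let E : V →ₗᵢ[ℝ] V := LinearIsometry.extend ⟨L, hLnorm⟩
  refine ⟨E.toLinearIsometryEquiv rfl, fun i => ?_⟩
  have hFi : F (Pi.single i 1) = u i := by simp [hF]
  have hGi : G (Pi.single i 1) = v i := by simp [hG]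
  rw [LinearIsometry.toLinearIsometryEquiv_apply, ← hFi, ← hGi, ← hLF]
  exact LinearIsometry.extend_apply ⟨L, hLnorm⟩ ⟨F (Pi.single i 1), _⟩

/-- Two families of points with the same mutual distances differ by a rigid transformation. -/
theorem exists_affineIsometryEquiv_of_norm_sub_eq {P W : ι → V}
    (h : ∀ i j, ‖P i - P j‖ = ‖W i - W j‖) : ∃ T : V ≃ᵃⁱ[ℝ] V, ∀ i, T (P i) = W i := by
  rcases isEmpty_or_nonempty ι with hι | ⟨⟨o⟩⟩
  · exact ⟨AffineIsometryEquiv.refl ℝ V, fun i => hι.elim i⟩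
  have hinner : ∀ i j, inner ℝ (P i - P o) (P j - P o) = inner ℝ (W i - W o) (W j - W o) := by
    intro i j
    simp only [real_inner_eq_norm_mul_self_add_norm_mul_self_sub_norm_sub_mul_self_div_two,
      sub_sub_sub_cancel_right, h]
  obtain ⟨E, hE⟩ := exists_linearIsometryEquiv_of_inner_eq hinner
  refine ⟨(AffineIsometryEquiv.vaddConst ℝ (P o)).symm.trans
    (E.toAffineIsometryEquiv.trans (AffineIsometryEquiv.vaddConst ℝ (W o))), fun i => ?_⟩
  simp [hE]

end Congruence

/-! ### The perspective problem -/

section Perspective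

/-- The representative of the line `ℝ p_i` whose inner product with the unit vector along `p_3`
is one. -/
noncomputable def unitDepth (p : Fin 4 → E3) (i : Fin 4) : E3 :=
  (‖p 3‖ / inner ℝ (p i) (p 3)) • p i

variable {P p : Fin 4 → E3}

theorem inner_unitDepth (p : Fin 4 → E3) (i j : Fin 4) :
    inner ℝ (unitDepth p i) (unitDepth p j) = inner ℝ (p i) (p j) * inner ℝ (p 3) (p 3)
      / (inner ℝ (p i) (p 3) * inner ℝ (p j) (p 3)) := by
  rw [unitDepth, unitDepth, real_inner_smul_left, real_inner_smul_right,
    real_inner_self_eq_norm_sq (p 3)]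
  ring

theorem inner_unitDepth_three (hp : ∀ i, inner ℝ (p i) (p 3) ≠ 0) (i : Fin 4) :
    inner ℝ (unitDepth p i) (unitDepth p 3) = 1 := by
  rw [inner_unitDepth]
  exact div_self (mul_ne_zero (hp i) (hp 3))

theorem exists_smul_unitDepth (hp : ∀ i, inner ℝ (p i) (p 3) ≠ 0) {i : Fin 4} {w : E3}
    (hw : w ∈ Submodule.span ℝ {p i}) : ∃ t : ℝ, w = t • unitDepth p i := by
  obtain ⟨s, rfl⟩ := Submodule.mem_span_singleton.mp hw
  have h3 : ‖p 3‖ ≠ 0 := by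
    intro h0
    exact hp 3 (by rw [real_inner_self_eq_norm_sq, h0]; norm_num)
  refine ⟨s * inner ℝ (p i) (p 3) / ‖p 3‖, ?_⟩
  rw [unitDepth, smul_smul]
  congr 1
  have := hp i
  field_simp

theorem norm_smul_sub_smul_sq (u v : E3) (s t : ℝ) :
    ‖s • u - t • v‖ ^ 2 = inner ℝ u u * (s * s) + inner ℝ v v * (t * t)
      - 2 * inner ℝ u v * (s * t) := by
  rw [norm_sub_sq_real, norm_smul, norm_smul, real_inner_smul_left, real_inner_smul_right,
    real_inner_self_eq_norm_sq, real_inner_self_eq_norm_sq, mul_pow, mul_pow,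
    Real.norm_eq_abs, Real.norm_eq_abs, sq_abs, sq_abs]
  ring

/-- The distances between the points with depths `z_i` on the lines `ℝ p_i`. -/
theorem norm_smul_unitDepth_sub_sq (hp : ∀ i, inner ℝ (p i) (p 3) ≠ 0) (z : Fin 4 → ℝ)
    (i : Fin 3) :
    ‖z (i + 1).castSucc • unitDepth p (i + 1).castSucc
        - z (i + 2).castSucc • unitDepth p (i + 2).castSucc‖ ^ 2 =
      coords P p (.b (i + 1)) * (z (i + 1).castSucc * z (i + 1).castSucc)
        + coords P p (.b (i + 2)) * (z (i + 2).castSucc * z (i + 2).castSucc)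
        - 2 * coords P p (.d i) * (z (i + 1).castSucc * z (i + 2).castSucc) ∧
    ‖z i.castSucc • unitDepth p i.castSucc - z 3 • unitDepth p 3‖ ^ 2 =
      z 3 * z 3 + coords P p (.b i) * (z i.castSucc * z i.castSucc)
        - 2 * (z i.castSucc * z 3) := by
  constructor
  · rw [norm_smul_sub_smul_sq, inner_unitDepth, inner_unitDepth, inner_unitDepth]
    simp only [coords, sq]
  · rw [norm_smul_sub_smul_sq, inner_unitDepth_three hp, inner_unitDepth_three hp,
      inner_unitDepth]
    simp only [coords, sq]
    ring

/-- A solution of the perspective problem provides a solution of the system. -/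
theorem Solvable.exists_satisfiesSystem (hp : ∀ i, inner ℝ (p i) (p 3) ≠ 0)
    (h : Solvable P p) : ∃ z, SatisfiesSystem (coords P p) z := by
  obtain ⟨T, hT⟩ := h
  choose z hz using fun i => exists_smul_unitDepth hp (hT i)
  refine ⟨z, fun i => ?_⟩
  have hdist : ∀ i j, ‖P i - P j‖ = ‖z i • unitDepth p i - z j • unitDepth p j‖ := by
    intro i j
    rw [← hz, ← hz, ← dist_eq_norm, ← dist_eq_norm, T.dist_map]
  obtain ⟨ha, hc⟩ := norm_smul_unitDepth_sub_sq (P := P) hp z i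
  rw [← hdist] at ha hc
  constructor
  · change ‖_‖ ^ 2 = _
    rw [ha]
    ring
  · change ‖_‖ ^ 2 = _
    rw [hc]
    ring

/-- If the squared distances of the `P_i` are `ε` times those of the points with depths `z_i` on
the lines, then the latter form the image of the `P_i` under a rigid transformation. The sign may
be negative only if all the points of each family coincide. -/
theorem exists_isSolution_of_signed {ε : ℝ} (hε : ε = 1 ∨ ε = -1) {z : Fin 4 → ℝ}
    (h : ∀ i : Fin 3,
      coords P p (.a i) = ε * ‖z (i + 1).castSucc • unitDepth p (i + 1).castSucc
        - z (i + 2).castSucc • unitDepth p (i + 2).castSucc‖ ^ 2 ∧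
      coords P p (.c i) =
        ε * ‖z i.castSucc • unitDepth p i.castSucc - z 3 • unitDepth p 3‖ ^ 2) :
    ∃ T : E3 ≃ᵃⁱ[ℝ] E3, IsSolution P p T ∧ ∀ i, T (P i) = z i • unitDepth p i := by
  have key : ∀ {u v : E3}, ‖u‖ ^ 2 = ε * ‖v‖ ^ 2 → ‖u‖ = ‖v‖ := by
    intro u v huv
    rcases hε with rfl | rfl
    · rw [one_mul] at huv
      exact (sq_eq_sq₀ (norm_nonneg _) (norm_nonneg _)).mp huv
    · -- For the negative sign both squares vanish.
      have hu : ‖u‖ ^ 2 = 0 := by nlinarith [sq_nonneg ‖u‖, sq_nonneg ‖v‖]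
      have hv : ‖v‖ ^ 2 = 0 := by linarith
      rw [pow_eq_zero_iff two_ne_zero] at hu hv
      rw [hu, hv]
  have symm : ∀ {i j}, ‖P i - P j‖ = ‖z i • unitDepth p i - z j • unitDepth p j‖ →
      ‖P j - P i‖ = ‖z j • unitDepth p j - z i • unitDepth p i‖ := by
    intro i j hij
    rw [norm_sub_rev, hij, norm_sub_rev]
  have diag : ∀ i, ‖P i - P i‖ = ‖z i • unitDepth p i - z i • unitDepth p i‖ := by simp
  have base := fun i => key (h i).1
  have apex := fun i => key (h i).2
  obtain ⟨T, hT⟩ := exists_affineIsometryEquiv_of_norm_sub_eq (P := P)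
    (W := fun i => z i • unitDepth p i) (by
      intro i j
      fin_cases i <;> fin_cases j
      exacts [diag 0, base 2, symm (base 1), apex 0, symm (base 2), diag 1, base 0, apex 1,
        base 1, symm (base 0), diag 2, apex 2, symm (apex 0), symm (apex 1), symm (apex 2),
        diag 3])
  refine ⟨T, fun i => ?_, hT⟩
  rw [hT, unitDepth]
  exact Submodule.smul_mem _ _ (Submodule.smul_mem _ _ (Submodule.mem_span_singleton_self _))

/-- If all `g_{i,j}` are defined at the values of the tuple and satisfy the constraints there,
then they are `± z_i z_j` for the depths `z` of a solution of the perspective problem. -/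
theorem exists_isSolution_of_constraints (hp : ∀ i, inner ℝ (p i) (p 3) ≠ 0)
    {τ : Equiv.Perm (Fin 3)} (hd : ∀ i, coords P p (.d i) ≠ 0)
    (hden : ∀ i, MvPolynomial.eval (coords P p) (denom (g τ i i)) ≠ 0)
    (h : Constraints τ (coords P p)) :
    ∃ T : E3 ≃ᵃⁱ[ℝ] E3, IsSolution P p T ∧
      ∀ i, MvPolynomial.eval (coords P p) (cleared (g τ i i)) ≠ 0 → T (P i) ≠ 0 := by
  have hgd : ∀ i, g τ i i = gDiag τ i := by
    intro i
    fin_cases i <;> rfl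
  set x := coords P p with hx
  set φ : Poly →+* ℝ := MvPolynomial.eval x with hφ
  have hX : (fun v => φ (MvPolynomial.X v)) = x := funext fun v => MvPolynomial.eval_X v
  set δ : Fin 4 → ℝ := fun i => φ (IsFractionRing.num Poly (gDiag τ i))
    / φ (IsFractionRing.den Poly (gDiag τ i)) with hδ
  have hdiag : ∀ i, HasValue φ (gDiag τ i) (δ i) := by
    intro i
    apply hasValue_of_den_ne_zero
    rw [← hgd]
    exact hden i
  have hg : ∀ i j, HasValue φ (g τ i j) (gValue x δ i j) := by
    intro i j
    have := hasValue_g (φ := φ) two_ne_zero (by simpa [hφ] using hd) hdiag i j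
    rwa [hX] at this
  obtain ⟨ε, z, hε, hz⟩ := exists_rank_one (gValue_symm x δ)
    (fun i j hij => by
      have hv := ((hg i i).mul (hg j j)).sub ((hg i j).mul (hg i j))
      rw [← sq, ← sq] at hv
      exact sub_eq_zero.mp (hv.num_eq_zero_iff.mp (h.1 i j hij)))
    (fun i j k hij hjk hik => sub_eq_zero.mp
      ((((hg i j).mul (hg j k)).sub ((hg i k).mul (hg j j))).num_eq_zero_iff.mp
        (h.2 i j k hij hjk hik)))
  have hδz : ∀ i, δ i = ε * (z i * z i) := fun i => by rw [← hz, gValue_diag]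
  obtain ⟨T, hT, hTz⟩ := exists_isSolution_of_signed (P := P) hε (z := z) (by
    intro i
    obtain ⟨ha, hc⟩ := gValue_linear_system (γ := δ) two_ne_zero hd i
    obtain ⟨ha', hc'⟩ := norm_smul_unitDepth_sub_sq (P := P) hp z i
    rw [ha', hc', ← hx, ha, hc]
    simp only [hz, hδz]
    constructor <;> ring)
  refine ⟨T, hT, fun i hi => ?_⟩
  rw [hTz, unitDepth, smul_smul]
  have hzi : z i ≠ 0 := by
    intro h0
    exact hi ((hg i i).num_eq_zero_iff.mpr (by rw [hz, h0]; ring))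
  have hpi : p i ≠ 0 := by
    intro h0
    exact hp i (by rw [h0, inner_zero_left])
  have hp3 : ‖p 3‖ ≠ 0 := by
    intro h0
    exact hp i (by rw [norm_eq_zero.mp h0, inner_zero_right])
  exact smul_ne_zero (mul_ne_zero hzi (div_ne_zero hp3 (hp i))) hpi

end Perspective

end FourPoint

theorem mainTheorem3 (τ : Equiv.Perm (Fin 3))
    (hτ : τ = Equiv.swap 0 1 ∨ τ = Equiv.swap 0 2)
    (P p : Fin 4 → FourPoint.E3) (hp : ∀ i, inner ℝ (p i) (p 3) ≠ 0) :
    (FourPoint.Solvable P p → FourPoint.Constraints τ (FourPoint.coords P p)) ∧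
    ((∀ i : Fin 3, FourPoint.coords P p (.d i) ≠ 0) →
      (∀ i : Fin 4,
        MvPolynomial.eval (FourPoint.coords P p) (FourPoint.denom (FourPoint.g τ i i)) ≠ 0) →
      FourPoint.Constraints τ (FourPoint.coords P p) →
      FourPoint.Solvable P p ∧
      ((∀ i : Fin 4,
          MvPolynomial.eval (FourPoint.coords P p) (FourPoint.cleared (FourPoint.g τ i i)) ≠ 0) →
        ∃ T : FourPoint.E3 ≃ᵃⁱ[ℝ] FourPoint.E3,
          FourPoint.IsSolution P p T ∧ ∀ i, T (P i) ≠ 0)) := by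
  refine ⟨fun h => ?_, fun hd hden hc => ?_⟩
  · obtain ⟨z, hz⟩ := h.exists_satisfiesSystem hp
    exact hz.constraints hτ
  · obtain ⟨T, hT, hT0⟩ := FourPoint.exists_isSolution_of_constraints hp hd hden hc
    exact ⟨⟨T, hT⟩, fun hg => ⟨T, hT, fun i => hT0 i (hg i)⟩⟩
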